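/- Let $(N,X_1,X_2,\dots)$ be a collective risk model with full FGM dependence: on a probability space, $N$ takes values in $\{0,1,2,\dots\}$; the $X_j$ are identically distributed and a.s. strictly positive; and, with $F_N$ the distribution function of $N$ and $F_X$ that of the $X_j$, for every integer $k\ge 1$ with $k\le \sup\{n:\Pr(N=n)>0\}$ there is a $(k+1)$-variate Farlie–Gumbel–Morgenstern copula $C$ such that $$\Pr(N\le n,\,X_1\le x_1,\dots,X_k\le x_k)=C\bigl(F_N(n),F_X(x_1),\dots,F_X(x_k)\bigr)\qquad (n\in\{0,1,2,\dots\},\ x_1,\dots,x_k\in\mathbb R).$$ Here a $(k+1)$-variate FGM copula is a function $$C(u_0,\dots,u_k)=\prod_{m=0}^{k}u_m\Bigl(1+\sum_{A\subseteq\{0,\dots,k\},\,|A|\ge 2}\theta_A\prod_{j\in A}(1-u_j)\Bigr),\qquad u\in[0,1]^{k+1},$$ whose real parameters satisfy $1+\sum_{|A|\ge2}\theta_A\prod_{j\in A}\varepsilon_j\ge 0$ for all $\varepsilon\in\{-1,1\}^{k+1}$. Let $S=\sum_{j=1}^{N}X_j$ (with $S=0$ if $N=0$) be the aggregate claim amount.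 Let $S^{(\triangle,\triangle)}$ be the aggregate claim amount in the model with the same $F_N$, $F_X$ whose Bernoulli sequence is comonotonic: $S^{(\triangle,\triangle)}=\sum_{j=1}^{N^\triangle}X_j^\triangle$, where $$N^\triangle=(1-I)\min(N_1,N_2)+I\max(N_1,N_2),\qquad X_j^\triangle=(1-I)\min(X_{1,j},X_{2,j})+I\max(X_{1,j},X_{2,j}),$$ with $\Pr(I=0)=\Pr(I=1)=\tfrac12$, $N_1,N_2\sim F_N$, $X_{1,j},X_{2,j}\sim F_X$ ($j\ge 1$), all these variables being independent. Then $$S\preceq_{icx}S^{(\triangle,\triangle)},$$ that is, $E[\phi(S)]\le E[\phi(S^{(\triangle,\triangle)})]$ in $(-\infty,\infty]$ for every nondecreasing convex function $\phi:\mathbb R\to\mathbb R$. The same holds with $S^{(\triangle,\triangle)}$ replaced by the aggregate claim amount of any collective risk model with the same $F_N$, $F_X$ in which, for every $k$ as above, the joint distribution of the claim number and the first $k$ claim amounts is given in the same way by the extreme positive dependence FGM copula, i.e. the one with $\theta_A=1$ for $|A|$ even and $\theta_A=0$ for $|A|$ odd. -/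

import Mathlib

open MeasureTheory ProbabilityTheory

namespace FGM

/-! ### Farlie-Gumbel-Morgenstern copulas -/

/-- The index sets `{j₁ < ⋯ < j_m}` with `2 ≤ m ≤ d` of the parameters of a `d`-variate FGM copula. -/
def indexSets (d : ℕ) : Finset (Finset (Fin d)) :=
  Finset.univ.filter fun A => 2 ≤ A.card

/-- Admissible parameters `θ_A`, `|A| ≥ 2` (the values of `θ` at smaller sets are not used). -/
def IsAdmissible {d : ℕ} (θ : Finset (Fin d) → ℝ) : Prop :=
  ∀ ε : Fin d → ℝ, (∀ j, ε j = 1 ∨ ε j = -1) →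
    0 ≤ 1 + ∑ A ∈ indexSets d, θ A * ∏ j ∈ A, ε j

/-- The function `∏ u_m * (1 + ∑_{|A| ≥ 2} θ_A ∏_{j ∈ A} (1 - u_j))`. -/
noncomputable def copula {d : ℕ} (θ : Finset (Fin d) → ℝ) (u : Fin d → ℝ) : ℝ :=
  (∏ m, u m) * (1 + ∑ A ∈ indexSets d, θ A * ∏ j ∈ A, (1 - u j))

/-- Parameters of the extreme positive dependence FGM copula. -/
def epdParam {d : ℕ} (A : Finset (Fin d)) : ℝ :=
  if Even A.card then 1 else 0

/-! ### Collective risk models -/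

section Models

variable {Ω : Type*} [MeasurableSpace Ω]

/-- `(N, X₁, X₂, …)` is a collective risk model with claim number law `νN` and claim amount law
`νX`; the claim amount `X_{j+1}` is `X j`. No independence is assumed. -/
structure IsCRM (P : Measure Ω) (N : Ω → ℕ) (X : ℕ → Ω → ℝ)
    (νN : Measure ℕ) (νX : Measure ℝ) : Prop where
  measurable_count : Measurable N
  measurable_claim : ∀ j, Measurable (X j)
  law_count : P.map N = νN
  law_claim : ∀ j, P.map (X j) = νX
  claim_pos : ∀ j, ∀ᵐ ω ∂P, 0 < X j ω

/-- The joint cdf of `(N, X₁, …, X_k)` is `C (F_N n, F_X x₁, …, F_X x_k)`. -/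
def HasJointCDF (P : Measure Ω) (N : Ω → ℕ) (X : ℕ → Ω → ℝ) (νN : Measure ℕ) (νX : Measure ℝ)
    (k : ℕ) (C : (Fin (k + 1) → ℝ) → ℝ) : Prop :=
  ∀ (n : ℕ) (x : Fin k → ℝ),
    P.real {ω | N ω ≤ n ∧ ∀ i : Fin k, X i ω ≤ x i} =
      C (Fin.cons (νN.real (Set.Iic n)) fun i => νX.real (Set.Iic (x i)))

/-- `k ≤ sup {n : Pr(N = n) > 0}`, the supremum being taken in `ℕ ∪ {∞}` and `k` finite. -/
def LeSupSupport (νN : Measure ℕ) (k : ℕ) : Prop :=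
  ∃ n, k ≤ n ∧ 0 < νN {n}

/-- Full FGM dependence: for `1 ≤ k ≤ sup {n : Pr(N = n) > 0}` the vector `(N, X₁, …, X_k)` is
defined with some `(k + 1)`-variate FGM copula. -/
def HasFGMDependence (P : Measure Ω) (N : Ω → ℕ) (X : ℕ → Ω → ℝ)
    (νN : Measure ℕ) (νX : Measure ℝ) : Prop :=
  ∀ k, 1 ≤ k → LeSupSupport νN k →
    ∃ θ : Finset (Fin (k + 1)) → ℝ, IsAdmissible θ ∧ HasJointCDF P N X νN νX k (copula θ)

/-- The same, with the extreme positive dependence FGM copula for every `k`. -/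
def HasEPDDependence (P : Measure Ω) (N : Ω → ℕ) (X : ℕ → Ω → ℝ)
    (νN : Measure ℕ) (νX : Measure ℝ) : Prop :=
  ∀ k, 1 ≤ k → LeSupSupport νN k → HasJointCDF P N X νN νX k (copula epdParam)

/-- The aggregate claim amount `S = X₁ + ⋯ + X_N`, which is `0` when `N = 0`. -/
def aggregate (N : Ω → ℕ) (X : ℕ → Ω → ℝ) (ω : Ω) : ℝ :=
  ∑ j ∈ Finset.range (N ω), X j ω

/-- The increasing convex order `Z ≼_icx Z'`. The last line says `E φ(Z) ≤ E φ(Z')` in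
`(-∞, ∞]`, which is where both expectations lie for nonnegative `Z`, `Z'`, as well as for
`Z`, `Z'` of finite expectation. -/
def IcxLE {Ω' : Type*} [MeasurableSpace Ω'] (P : Measure Ω) (Z : Ω → ℝ)
    (P' : Measure Ω') (Z' : Ω' → ℝ) : Prop :=
  ∀ φ : ℝ → ℝ, Monotone φ → ConvexOn ℝ Set.univ φ →
    Integrable (fun ω => φ (Z' ω)) P' →
      Integrable (fun ω => φ (Z ω)) P ∧ ∫ ω, φ (Z ω) ∂P ≤ ∫ ω, φ (Z' ω) ∂P'

end Models

/-! ### The model with a comonotonic Bernoulli sequence -/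

/-- A point is `(I, (N₁, N₂), (X_{1,j}, X_{2,j})_j)`. -/
abbrev EPDSpace : Type := Bool × (ℕ × ℕ) × (ℕ → ℝ × ℝ)

/-- Under this law `I` is a symmetric Bernoulli variable, `N₁, N₂` have law `νN`, all `X_{1,j}`
and `X_{2,j}` have law `νX`, and all these variables are independent. -/
noncomputable def epdMeasure (νN : Measure ℕ) (νX : Measure ℝ) [IsProbabilityMeasure νN]
    [IsProbabilityMeasure νX] : Measure EPDSpace :=
  (PMF.uniformOfFintype Bool).toMeasure.prod
    ((νN.prod νN).prod (Measure.infinitePi fun _ : ℕ => νX.prod νX))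

/-- The Bernoulli sequence `(I₀, I₁, …)`: comonotonic, `I_j = I` for all `j`. -/
def epdBernoulli (_j : ℕ) (ω : EPDSpace) : Bool := ω.1

/-- `N = (1 - I₀) N_[1] + I₀ N_[2]` with `N_[1] = min (N₁, N₂)` and `N_[2] = max (N₁, N₂)`. -/
def epdCount (ω : EPDSpace) : ℕ :=
  if epdBernoulli 0 ω then max ω.2.1.1 ω.2.1.2 else min ω.2.1.1 ω.2.1.2

/-- `X_{j+1} = (1 - I_{j+1}) X_{[1],j+1} + I_{j+1} X_{[2],j+1}`. -/
noncomputable def epdClaim (j : ℕ) (ω : EPDSpace) : ℝ :=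
  if epdBernoulli (j + 1) ω then max (ω.2.2 j).1 (ω.2.2 j).2 else min (ω.2.2 j).1 (ω.2.2 j).2

end FGM

/-!
The factor `u (1 + ε (1 - u))` is `u (2 - u)` for `ε = 1` and `u ^ 2` for `ε = -1`, which are the
distribution functions of the minimum and of the maximum of two independent uniform variables.
Expanding products and using the orthogonality of the characters `∏ j ∈ A, ε j` of the sign group,
an FGM copula is the mixture, with weights
`2⁻ᵈ (1 + ∑ θ_A ∏ j ∈ A, ε j)`, of the products of such distribution functions
(`copula_eq_mixture`). Admissibility of `θ` says that the weights are nonnegative, and as the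
margins of the copula are uniform, each sign is symmetric under these weights
(`sum_ite_mixWeight`). Hence the law of `(N, X₁, …, X_k)` is a mixture of the laws of vectors whose
coordinates are minima or maxima of independent pairs, the set `a` of the coordinates where the
maximum is taken being random (`lintegral_of_mixture`). For the extreme positive dependence copula,
and for the model with a comonotonic Bernoulli sequence, `a` is `∅` or everything, with probability
`1/2` each.

On fixed pairs, the sum of the first `min N k` claims is increasing and supermodular in `a`, and so
is its image under an increasing convex function. A supermodular set function is bounded by a
modular one that agrees with it at `∅` and at the full set (`exists_modular_majorant`); as the
expectation of a modular function depends on the margins only, the random set concentrated on `∅`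
and the full set is the worst case (`sum_mul_le_half_of_supermodular`). This inequality holds
pointwise in the pairs, so no integrability is needed to integrate it. Fatou's lemma removes the
truncation at `k` (`icxLE_of_truncSum`), after the convex function has been normalized to vanish
at `0`, which makes it nonnegative on nonnegative sums.
-/

namespace FGM

/-! ### Supermodular set functions -/

/-- A supermodular set function lies below a modular one that agrees with it at `∅` and at `s`:
the weights are the increments along a maximal chain from `∅` to `s`. -/
theorem exists_modular_majorant {ι : Type*} [DecidableEq ι] (G : Finset ι → ℝ)
    (hG : ∀ a b, G a + G b ≤ G (a ∩ b) + G (a ∪ b)) (s : Finset ι) :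
    ∃ w : ι → ℝ, G s = G ∅ + ∑ i ∈ s, w i ∧ ∀ a ⊆ s, G a ≤ G ∅ + ∑ i ∈ a, w i := by
  induction s using Finset.induction_on with
  | empty =>
    refine ⟨0, by simp, fun a ha => ?_⟩
    simp [Finset.subset_empty.1 ha]
  | insert i s hi ih =>
    obtain ⟨w, hs, hw⟩ := ih
    have hoff : ∀ a ⊆ s, ∑ j ∈ a, Function.update w i (G (insert i s) - G s) j = ∑ j ∈ a, w j :=
      fun a ha => Finset.sum_congr rfl fun j hj =>
        Function.update_of_ne (by rintro rfl; exact hi (ha hj)) _ _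
    refine ⟨Function.update w i (G (insert i s) - G s), ?_, fun a ha => ?_⟩
    · rw [Finset.sum_insert hi, hoff s subset_rfl, Function.update_self]
      linarith
    · by_cases hia : i ∈ a
      · have hsub : a.erase i ⊆ s := by
          intro j hj
          rw [Finset.mem_erase] at hj
          exact (Finset.mem_insert.1 (ha hj.2)).resolve_left hj.1
        have hinter : a ∩ s = a.erase i := by
          ext j
          have := @ha j
          grind
        have hunion : a ∪ s = insert i s := by
          ext j
          have := @ha j
          grind
        have h1 := hG a s
        have h2 := hw _ hsub
        rw [hinter, hunion] at h1
        rw [← Finset.add_sum_erase a _ hia, hoff _ hsub, Function.update_self]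
        linarith
      · have hsub : a ⊆ s := (Finset.subset_insert_iff_of_notMem hia).1 ha
        rw [hoff a hsub]
        exact hw a hsub

/-- Among the random sets that contain each index with probability `1/2`, the one which is `∅` or
everything with probability `1/2` each maximizes the expectation of a supermodular function. -/
theorem sum_mul_le_half_of_supermodular {ι : Type*} [Fintype ι] [DecidableEq ι]
    (G : Finset ι → ℝ) (hG : ∀ a b, G a + G b ≤ G (a ∩ b) + G (a ∪ b))
    (p : Finset ι → ℝ) (hp : ∀ a, 0 ≤ p a) (hsum : ∑ a, p a = 1)
    (hmarg : ∀ i, (∑ a, if i ∈ a then p a else 0) = 1 / 2) :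
    ∑ a, p a * G a ≤ 1 / 2 * G ∅ + 1 / 2 * G Finset.univ := by
  obtain ⟨w, hu, hw⟩ := exists_modular_majorant G hG Finset.univ
  calc ∑ a, p a * G a ≤ ∑ a, p a * (G ∅ + ∑ i ∈ a, w i) :=
        Finset.sum_le_sum fun a _ => mul_le_mul_of_nonneg_left (hw a (Finset.subset_univ a)) (hp a)
    _ = G ∅ + ∑ i, (∑ a, if i ∈ a then p a else 0) * w i := by
        simp_rw [mul_add, Finset.sum_add_distrib, ← Finset.sum_mul, hsum, one_mul]
        congr 1
        simp_rw [Finset.sum_mul]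
        rw [Finset.sum_comm]
        refine Finset.sum_congr rfl fun a _ => ?_
        simp_rw [ite_mul, zero_mul]
        rw [Finset.sum_ite_mem, Finset.univ_inter, Finset.mul_sum]
    _ = 1 / 2 * G ∅ + 1 / 2 * G Finset.univ := by
        simp_rw [hmarg, ← Finset.mul_sum]
        rw [hu]
        ring

/-- For a convex increasing function, spreading out two points and increasing their sum increases
the sum of the values. -/
theorem add_le_add_of_convexOn_of_monotone {ψ : ℝ → ℝ} (hm : Monotone ψ)
    (hc : ConvexOn ℝ Set.univ ψ) {A B C D : ℝ} (hCA : C ≤ A) (hCB : C ≤ B) (hAD : A ≤ D)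
    (hBD : B ≤ D) (hsum : A + B ≤ C + D) : ψ A + ψ B ≤ ψ C + ψ D := by
  have hB := hm (show B ≤ C + D - A by linarith)
  rcases eq_or_lt_of_le (hCA.trans hAD) with h | h
  · obtain rfl : A = C := le_antisymm (hAD.trans h.ge) hCA
    have := hm hBD
    linarith
  · -- `A` and `C + D - A` divide the segment from `C` to `D` in opposite ratios
    have hne : D - C ≠ 0 := (sub_pos.2 h).ne'
    have hs : 0 ≤ (D - A) / (D - C) := div_nonneg (by linarith) (by linarith)
    have ht : 0 ≤ (A - C) / (D - C) := div_nonneg (by linarith) (by linarith)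
    have hst : (D - A) / (D - C) + (A - C) / (D - C) = 1 := by field_simp; ring
    have h1 := hc.2 (Set.mem_univ C) (Set.mem_univ D) hs ht hst
    have h2 := hc.2 (Set.mem_univ C) (Set.mem_univ D) ht hs (by rw [add_comm]; exact hst)
    simp only [smul_eq_mul] at h1 h2
    have e1 : (D - A) / (D - C) * C + (A - C) / (D - C) * D = A := by field_simp; ring
    have e2 : (A - C) / (D - C) * C + (D - A) / (D - C) * D = C + D - A := by field_simp; ring
    rw [e1] at h1
    rw [e2] at h2
    have e3 : ψ C + ψ D = ((D - A) / (D - C) + (A - C) / (D - C)) * (ψ C + ψ D) := by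
      rw [hst, one_mul]
    linarith

/-! ### FGM copulas as mixtures of products -/

/-- The distribution function on `[0, 1]` of the minimum of two independent uniform variables, or
of their maximum at the indices in `a`. -/
noncomputable def levelCDF {ι : Type*} [DecidableEq ι] (a : Finset ι) (m : ι) (u : ℝ) : ℝ :=
  if m ∈ a then u ^ 2 else u * (2 - u)

/-- The sign `1` outside `a` and `-1` on `a`. -/
def levelSign {ι : Type*} [DecidableEq ι] (a : Finset ι) (m : ι) : ℝ := if m ∈ a then -1 else 1

/-- The weight of the set `a` in the representation of the copula with parameters `θ` as a
mixture of products. -/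
noncomputable def mixWeight {d : ℕ} (θ : Finset (Fin d) → ℝ) (a : Finset (Fin d)) : ℝ :=
  (1 + ∑ A ∈ indexSets d, θ A * ∏ j ∈ A, levelSign a j) / 2 ^ d

theorem mixWeight_nonneg {d : ℕ} {θ : Finset (Fin d) → ℝ} (hθ : IsAdmissible θ)
    (a : Finset (Fin d)) : 0 ≤ mixWeight θ a := by
  refine div_nonneg (hθ _ fun j => ?_) (by positivity)
  unfold levelSign
  split_ifs <;> simp

/-- The orthogonality of the characters of the sign group, in generating form. -/
theorem sum_prod_levelSign {d : ℕ} (A : Finset (Fin d)) (u : Fin d → ℝ) :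
    ∑ a : Finset (Fin d), (∏ j ∈ A, levelSign a j) * ∏ m, levelCDF a m (u m) =
      2 ^ d * ((∏ m, u m) * ∏ j ∈ A, (1 - u j)) := by
  have h := Fintype.prod_add (fun m => (if m ∈ A then -1 else 1) * u m ^ 2)
    fun m => u m * (2 - u m)
  have hL : ∀ m, (if m ∈ A then (-1 : ℝ) else 1) * u m ^ 2 + u m * (2 - u m) =
      2 * (u m * if m ∈ A then 1 - u m else 1) := by
    intro m
    split_ifs <;> ring
  simp_rw [hL, Finset.prod_mul_distrib] at h
  rw [Finset.prod_const, Finset.card_univ, Fintype.card_fin, Finset.prod_ite_mem,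
    Finset.univ_inter] at h
  rw [h]
  refine Finset.sum_congr rfl fun a _ => ?_
  have h1 : ∏ m, levelCDF a m (u m) = (∏ m ∈ a, u m ^ 2) * ∏ m ∈ aᶜ, u m * (2 - u m) := by
    rw [← Finset.prod_mul_prod_compl a]
    congr 1 <;> refine Finset.prod_congr rfl fun m hm => ?_
    · simp [levelCDF, hm]
    · simp [levelCDF, Finset.mem_compl.1 hm]
  have h2 : ∏ j ∈ A, levelSign a j = ∏ m ∈ a, if m ∈ A then (-1 : ℝ) else 1 := by
    unfold levelSign
    rw [Finset.prod_ite_mem, Finset.prod_ite_mem, Finset.inter_comm]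
  rw [h1, h2, Finset.prod_mul_distrib, mul_assoc]

theorem copula_eq_mixture {d : ℕ} (θ : Finset (Fin d) → ℝ) (u : Fin d → ℝ) :
    copula θ u = ∑ a, mixWeight θ a * ∏ m, levelCDF a m (u m) := by
  have h0 := sum_prod_levelSign ∅ u
  simp only [Finset.prod_empty, one_mul, mul_one] at h0
  have : ∀ a, mixWeight θ a * ∏ m, levelCDF a m (u m) =
      (∏ m, levelCDF a m (u m) + ∑ A ∈ indexSets d,
        θ A * ((∏ j ∈ A, levelSign a j) * ∏ m, levelCDF a m (u m))) / 2 ^ d := by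
    intro a
    simp_rw [mixWeight, ← mul_assoc, ← Finset.sum_mul]
    ring
  simp_rw [this]
  rw [← Finset.sum_div, Finset.sum_add_distrib, h0, Finset.sum_comm]
  simp_rw [← Finset.mul_sum, sum_prod_levelSign]
  rw [eq_div_iff (by positivity), copula, mul_add, mul_one, Finset.mul_sum, add_mul,
    Finset.sum_mul]
  congr 1
  · ring
  · exact Finset.sum_congr rfl fun A _ => by ring

/-- The univariate margins of an FGM copula are uniform. -/
theorem copula_update_one {d : ℕ} (θ : Finset (Fin d) → ℝ) (i : Fin d) (t : ℝ) :
    copula θ (Function.update (fun _ => 1) i t) = t := by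
  have h1 : ∏ m, Function.update (fun _ : Fin d => (1 : ℝ)) i t m = t := by
    rw [Finset.prod_update_of_mem (Finset.mem_univ i)]
    simp
  rw [copula, h1, Finset.sum_eq_zero, add_zero, mul_one]
  intro A hA
  have hA2 : 1 < A.card := (Finset.mem_filter.1 hA).2
  obtain ⟨j, hj, hji⟩ := Finset.exists_mem_ne hA2 i
  rw [Finset.prod_eq_zero hj (by simp [Function.update_of_ne hji]), mul_zero]

theorem sum_mixWeight_mul_levelCDF {d : ℕ} (θ : Finset (Fin d) → ℝ) (i : Fin d) (t : ℝ) :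
    ∑ a, mixWeight θ a * levelCDF a i t = t := by
  refine Eq.trans ?_ ((copula_eq_mixture θ _).symm.trans (copula_update_one θ i t))
  refine Finset.sum_congr rfl fun a _ => ?_
  congr 1
  rw [Fintype.prod_eq_single i]
  · simp
  · intro j hj
    rw [Function.update_of_ne hj]
    unfold levelCDF
    split_ifs <;> norm_num

theorem sum_mixWeight {d : ℕ} (θ : Finset (Fin (d + 1)) → ℝ) : ∑ a, mixWeight θ a = 1 := by
  have h := sum_mixWeight_mul_levelCDF θ 0 1
  have : ∀ a : Finset (Fin (d + 1)), levelCDF a 0 1 = 1 := by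
    intro a
    unfold levelCDF
    split_ifs <;> norm_num
  simpa [this] using h

theorem sum_ite_mixWeight {d : ℕ} (θ : Finset (Fin (d + 1)) → ℝ) (i : Fin (d + 1)) :
    (∑ a, if i ∈ a then mixWeight θ a else 0) = 1 / 2 := by
  have h := sum_mixWeight_mul_levelCDF θ i (1 / 2)
  have h' : ∀ a, mixWeight θ a * levelCDF a i (1 / 2) =
      3 / 4 * mixWeight θ a - 1 / 2 * if i ∈ a then mixWeight θ a else 0 := by
    intro a
    unfold levelCDF
    split_ifs <;> ring
  simp_rw [h'] at h
  rw [Finset.sum_sub_distrib, ← Finset.mul_sum, ← Finset.mul_sum, sum_mixWeight] at h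
  linarith

/-- Weights `1/2` at `∅` and at the full set, which are distinct in dimension at least one. -/
noncomputable def extremeWeight {d : ℕ} (a : Finset (Fin d)) : ℝ :=
  (if a = ∅ then 1 / 2 else 0) + if a = Finset.univ then 1 / 2 else 0

theorem extremeWeight_nonneg {d : ℕ} (a : Finset (Fin d)) : 0 ≤ extremeWeight a := by
  unfold extremeWeight
  split_ifs <;> norm_num

theorem copula_epdParam {d : ℕ} (u : Fin d → ℝ) :
    copula epdParam u = ∑ a, extremeWeight a * ∏ m, levelCDF a m (u m) := by
  have hplus := Finset.prod_one_add (f := fun m => 1 - u m) Finset.univ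
  have hminus := Finset.prod_one_add (f := fun m => -(1 - u m)) Finset.univ
  simp_rw [Finset.prod_neg, Finset.powerset_univ] at hplus hminus
  -- the average of the two expansions keeps the sets of even cardinality
  have heven : 1 + ∑ A ∈ indexSets d, epdParam A * ∏ j ∈ A, (1 - u j) =
      ∑ A : Finset (Fin d), epdParam A * ∏ j ∈ A, (1 - u j) := by
    have hsub : insert ∅ (indexSets d) ⊆ (Finset.univ : Finset (Finset (Fin d))) :=
      Finset.subset_univ _
    rw [← Finset.sum_subset hsub, Finset.sum_insert (by simp [indexSets])]
    · simp [epdParam]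
    · intro A _ hA
      have : A.card = 1 := by
        simp only [indexSets, Finset.mem_insert, Finset.mem_filter, Finset.mem_univ, true_and,
          not_or, not_le, ← Finset.card_eq_zero] at hA
        omega
      simp [epdParam, this]
  have havg : ∑ A : Finset (Fin d), epdParam A * ∏ j ∈ A, (1 - u j) =
      1 / 2 * ∏ m, (1 + (1 - u m)) + 1 / 2 * ∏ m, (1 + -(1 - u m)) := by
    rw [hplus, hminus, Finset.mul_sum, Finset.mul_sum, ← Finset.sum_add_distrib]
    refine Finset.sum_congr rfl fun A _ => ?_
    unfold epdParam
    split_ifs with h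
    · rw [h.neg_one_pow]; ring
    · rw [(Nat.not_even_iff_odd.1 h).neg_one_pow]; ring
  rw [copula, heven, havg]
  simp only [extremeWeight, add_mul, ite_mul, zero_mul, Finset.sum_add_distrib,
    Finset.sum_ite_eq', Finset.mem_univ, if_true, levelCDF, Finset.notMem_empty, if_false]
  rw [mul_add, mul_left_comm, mul_left_comm _ (1 / 2), ← Finset.prod_mul_distrib,
    ← Finset.prod_mul_distrib]
  congr 2 <;> refine Finset.prod_congr rfl fun m _ => by ring

/-! ### The law of a model whose copula is a mixture of products -/

/-- The maximum or the minimum of a pair. -/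
def level {α : Type*} [LinearOrder α] (b : Prop) [Decidable b] (z : α × α) : α :=
  if b then max z.1 z.2 else min z.1 z.2

theorem measurable_level {α : Type*} [LinearOrder α] [TopologicalSpace α] [OrderClosedTopology α]
    [MeasurableSpace α] [OpensMeasurableSpace α] [SecondCountableTopology α]
    (b : Prop) [Decidable b] : Measurable (level b : α × α → α) := by
  unfold level
  split_ifs
  · exact measurable_fst.max measurable_snd
  · exact measurable_fst.min measurable_snd

theorem level_and {α : Type*} [LinearOrder α] (b c : Prop) [Decidable b] [Decidable c]
    (z : α × α) : level (b ∧ c) z = min (level b z) (level c z) := by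
  by_cases hb : b <;> by_cases hc : c <;> simp [level, hb, hc]

theorem level_or {α : Type*} [LinearOrder α] (b c : Prop) [Decidable b] [Decidable c]
    (z : α × α) : level (b ∨ c) z = max (level b z) (level c z) := by
  by_cases hb : b <;> by_cases hc : c <;> simp [level, hb, hc]

theorem le_level {α : Type*} [LinearOrder α] (b : Prop) [Decidable b] {z : α × α} {c : α}
    (h1 : c ≤ z.1) (h2 : c ≤ z.2) : c ≤ level b z := by
  unfold level
  split_ifs
  · exact le_max_of_le_left h1
  · exact le_min h1 h2

theorem prod_real_level_le {α : Type*} [LinearOrder α] [TopologicalSpace α]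
    [OrderClosedTopology α] [MeasurableSpace α] [OpensMeasurableSpace α]
    (ν : Measure α) [IsProbabilityMeasure ν] {ι : Type*} [DecidableEq ι] (a : Finset ι) (m : ι)
    (t : α) :
    (ν.prod ν).real {z | level (m ∈ a) z ≤ t} = levelCDF a m (ν.real (Set.Iic t)) := by
  by_cases h : m ∈ a
  · have : {z : α × α | level (m ∈ a) z ≤ t} = Set.Iic t ×ˢ Set.Iic t := by
      ext z
      simp only [level, h, if_true, Set.mem_ofPred_eq, max_le_iff, Set.mem_prod, Set.mem_Iic]
    rw [this, measureReal_prod_prod, levelCDF, if_pos h, sq]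
  · have : {z : α × α | level (m ∈ a) z ≤ t} = ((Set.Iic t)ᶜ ×ˢ (Set.Iic t)ᶜ)ᶜ := by
      ext z
      simp only [level, h, if_false, Set.mem_ofPred_eq, min_le_iff, Set.mem_compl_iff,
        Set.mem_prod, Set.mem_Iic]
      tauto
    rw [this, probReal_compl_eq_one_sub (measurableSet_Iic.compl.prod measurableSet_Iic.compl),
      measureReal_prod_prod, probReal_compl_eq_one_sub measurableSet_Iic, levelCDF, if_neg h]
    ring

/-- The law of independent pairs `(N₁, N₂)` and `(X_{1,j}, X_{2,j})`, `j ≥ 1`, with independent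
entries of laws `νN` and `νX`. -/
noncomputable abbrev pairMeasure (νN : Measure ℕ) (νX : Measure ℝ) [IsProbabilityMeasure νN]
    [IsProbabilityMeasure νX] : Measure ((ℕ × ℕ) × (ℕ → ℝ × ℝ)) :=
  (νN.prod νN).prod (Measure.infinitePi fun _ : ℕ => νX.prod νX)

/-- The claim number and the first `k` claim amounts, with the maximum chosen at the coordinates
in `a` and the minimum at the others. Coordinate `0` is the claim number. -/
noncomputable def levelVector {k : ℕ} (a : Finset (Fin (k + 1))) (z : (ℕ × ℕ) × (ℕ → ℝ × ℝ)) :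
    ℕ × (Fin k → ℝ) :=
  (level (0 ∈ a) z.1, fun i => level (i.succ ∈ a) (z.2 i))

theorem measurable_levelVector {k : ℕ} (a : Finset (Fin (k + 1))) :
    Measurable (levelVector a) := by
  refine ((measurable_level _).comp measurable_fst).prodMk (measurable_pi_lambda _ fun i => ?_)
  exact (measurable_level _).comp ((measurable_pi_apply _).comp measurable_snd)

/-- The lower boxes of `ℕ × (Fin k → ℝ)`. -/
def lowerBoxes (k : ℕ) : Set (Set (ℕ × (Fin k → ℝ))) :=
  Set.image2 (· ×ˢ ·) (Set.range Set.Iic)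
    (Set.univ.pi '' Set.univ.pi fun _ : Fin k => Set.range (Set.Iic : ℝ → Set ℝ))

theorem isPiSystem_lowerBoxes (k : ℕ) : IsPiSystem (lowerBoxes k) :=
  isPiSystem_Iic.prod (IsPiSystem.pi fun _ => isPiSystem_Iic)

theorem isCountablySpanning_range_Iic {α : Type*} [Preorder α] (f : ℕ → α)
    (hf : ∀ x, ∃ n, x ≤ f n) : IsCountablySpanning (Set.range (Set.Iic : α → Set α)) :=
  ⟨fun n => Set.Iic (f n), fun n => ⟨f n, rfl⟩, Set.iUnion_eq_univ_iff.2 hf⟩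

theorem generateFrom_lowerBoxes (k : ℕ) :
    (inferInstance : MeasurableSpace (ℕ × (Fin k → ℝ))) =
      MeasurableSpace.generateFrom (lowerBoxes k) := by
  have hR : IsCountablySpanning (Set.range (Set.Iic : ℝ → Set ℝ)) :=
    isCountablySpanning_range_Iic (fun n => (n : ℝ)) exists_nat_ge
  refine (generateFrom_eq_prod ?_ (generateFrom_eq_pi (fun _ => ?_) fun _ => hR)
    (isCountablySpanning_range_Iic id fun n => ⟨n, le_rfl⟩) (.pi fun _ => hR)).symm
  · exact (borel_eq_generateFrom_Iic ℕ).symm.trans BorelSpace.measurable_eq.symm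
  · exact (borel_eq_generateFrom_Iic ℝ).symm.trans BorelSpace.measurable_eq.symm

theorem pairMeasure_levelVector_le (νN : Measure ℕ) (νX : Measure ℝ) [IsProbabilityMeasure νN]
    [IsProbabilityMeasure νX] {k : ℕ} (a : Finset (Fin (k + 1))) (n : ℕ) (x : Fin k → ℝ) :
    (pairMeasure νN νX).real (levelVector a ⁻¹' (Set.Iic n ×ˢ Set.univ.pi fun i => Set.Iic (x i)))
      = ∏ m, levelCDF a m
          ((Fin.cons (νN.real (Set.Iic n)) fun i => νX.real (Set.Iic (x i)) : Fin (k + 1) → ℝ)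
            m) := by
  have hset : levelVector a ⁻¹' (Set.Iic n ×ˢ Set.univ.pi fun i => Set.Iic (x i)) =
      {z : ℕ × ℕ | level (0 ∈ a) z ≤ n} ×ˢ
        ⋂ i : Fin k, (fun y : ℕ → ℝ × ℝ => y i) ⁻¹' {z | level (i.succ ∈ a) z ≤ x i} := by
    ext z
    simp [levelVector, Pi.le_def]
  have hmeas : ∀ i : Fin k, MeasurableSet {z : ℝ × ℝ | level (i.succ ∈ a) z ≤ x i} :=
    fun i => measurable_level _ measurableSet_Iic
  have hind : (Measure.infinitePi fun _ : ℕ => νX.prod νX).real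
      (⋂ i : Fin k, (fun y : ℕ → ℝ × ℝ => y i) ⁻¹' {z | level (i.succ ∈ a) z ≤ x i}) =
      ∏ i : Fin k, (νX.prod νX).real {z | level (i.succ ∈ a) z ≤ x i} := by
    have hpi : (⋂ i : Fin k, (fun y : ℕ → ℝ × ℝ => y i) ⁻¹' {z | level (i.succ ∈ a) z ≤ x i}) =
        Set.pi (Finset.range k : Set ℕ) fun j => if h : j < k then
          {z | level ((⟨j, h⟩ : Fin k).succ ∈ a) z ≤ x ⟨j, h⟩} else Set.univ := by
      ext y
      simp only [Set.mem_iInter, Set.mem_preimage, Set.mem_pi, Finset.coe_range, Set.mem_Iio]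
      constructor
      · intro h j hj
        rw [dif_pos hj]
        exact h ⟨j, hj⟩
      · intro h i
        have := h i i.2
        rwa [dif_pos i.2] at this
    rw [hpi, measureReal_def, Measure.infinitePi_pi, ENNReal.toReal_prod, Finset.prod_range]
    · refine Finset.prod_congr rfl fun i _ => ?_
      rw [dif_pos i.2, measureReal_def]
    · intro j hj
      rw [dif_pos (Finset.mem_range.1 hj)]
      exact hmeas _
  rw [hset, measureReal_prod_prod, hind, Fin.prod_univ_succ, prod_real_level_le]
  simp_rw [prod_real_level_le]
  rfl

/-- If the copula of `(N, X₁, …, X_k)` is a mixture of the products `∏ levelCDF a m`, then the law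
of the vector is the same mixture of the laws of the vectors `levelVector a`. -/
theorem lintegral_of_mixture {Ω : Type*} [MeasurableSpace Ω] {P : Measure Ω}
    [IsProbabilityMeasure P] {νN : Measure ℕ} {νX : Measure ℝ} [IsProbabilityMeasure νN]
    [IsProbabilityMeasure νX] {N : Ω → ℕ} {X : ℕ → Ω → ℝ} (hN : Measurable N)
    (hX : ∀ j, Measurable (X j)) {k : ℕ} {C : (Fin (k + 1) → ℝ) → ℝ}
    (hJ : HasJointCDF P N X νN νX k C) {p : Finset (Fin (k + 1)) → ℝ} (hp : ∀ a, 0 ≤ p a)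
    (hC : ∀ u, C u = ∑ a, p a * ∏ m, levelCDF a m (u m))
    {f : ℕ × (Fin k → ℝ) → ENNReal} (hf : Measurable f) :
    ∫⁻ ω, f (N ω, fun i => X i ω) ∂P =
      ∑ a, ENNReal.ofReal (p a) * ∫⁻ z, f (levelVector a z) ∂(pairMeasure νN νX) := by
  have hV : Measurable fun ω => (N ω, fun i : Fin k => X i ω) :=
    hN.prodMk (measurable_pi_lambda _ fun i => hX i)
  have hbox : ∀ (n : ℕ) (x : Fin k → ℝ),
      P.map (fun ω => (N ω, fun i : Fin k => X i ω))
        (Set.Iic n ×ˢ Set.univ.pi fun i => Set.Iic (x i)) =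
      (∑ a, ENNReal.ofReal (p a) • (pairMeasure νN νX).map (levelVector a))
        (Set.Iic n ×ˢ Set.univ.pi fun i => Set.Iic (x i)) := by
    intro n x
    have hms : MeasurableSet (Set.Iic n ×ˢ Set.univ.pi fun i => Set.Iic (x i)) :=
      measurableSet_Iic.prod (.univ_pi fun i => measurableSet_Iic)
    have hpre : (fun ω => (N ω, fun i : Fin k => X i ω)) ⁻¹'
        (Set.Iic n ×ˢ Set.univ.pi fun i => Set.Iic (x i)) =
        {ω | N ω ≤ n ∧ ∀ i : Fin k, X i ω ≤ x i} := by
      ext ω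
      simp [Pi.le_def]
    rw [Measure.map_apply hV hms, hpre, ← ofReal_measureReal, hJ n x, hC,
      ENNReal.ofReal_sum_of_nonneg, Measure.finsetSum_apply]
    · refine Finset.sum_congr rfl fun a _ => ?_
      rw [← pairMeasure_levelVector_le, ENNReal.ofReal_mul (hp a), ofReal_measureReal,
        Measure.smul_apply, Measure.map_apply (measurable_levelVector a) hms, smul_eq_mul]
    · intro a _
      rw [← pairMeasure_levelVector_le]
      exact mul_nonneg (hp a) measureReal_nonneg
  have hlaw : P.map (fun ω => (N ω, fun i : Fin k => X i ω)) =
      ∑ a, ENNReal.ofReal (p a) • (pairMeasure νN νX).map (levelVector a) := by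
    have : IsProbabilityMeasure (P.map fun ω => (N ω, fun i : Fin k => X i ω)) :=
      Measure.isProbabilityMeasure_map hV.aemeasurable
    refine Measure.ext_of_generateFrom_of_iUnion (lowerBoxes k)
      (fun n => Set.Iic n ×ˢ Set.univ.pi fun _ => Set.Iic (n : ℝ)) (generateFrom_lowerBoxes k)
      (isPiSystem_lowerBoxes k) ?_ ?_ (fun n => measure_ne_top _ _) ?_
    · refine Set.iUnion_eq_univ_iff.2 fun y => ?_
      obtain ⟨n, hn⟩ := exists_nat_ge (∑ i, |y.2 i|)
      refine ⟨max y.1 n, Set.mem_Iic.2 (le_max_left _ _), fun i _ => ?_⟩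
      calc y.2 i ≤ |y.2 i| := le_abs_self _
        _ ≤ ∑ i, |y.2 i| :=
          Finset.single_le_sum (f := fun i => |y.2 i|) (fun _ _ => abs_nonneg _) (Finset.mem_univ i)
        _ ≤ (max y.1 n : ℕ) := hn.trans (by exact_mod_cast le_max_right _ _)
    · exact fun n => ⟨_, ⟨n, rfl⟩, _, ⟨_, fun _ _ => ⟨(n : ℝ), rfl⟩, rfl⟩, rfl⟩
    · rintro _ ⟨_, ⟨n, rfl⟩, _, ⟨s, hs, rfl⟩, rfl⟩
      choose x hx using fun i => hs i (Set.mem_univ i)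
      obtain rfl : (fun i => Set.Iic (x i)) = s := funext hx
      exact hbox n x
  rw [← lintegral_map hf hV, hlaw, lintegral_finsetSum_measure]
  refine Finset.sum_congr rfl fun a _ => ?_
  rw [lintegral_smul_measure, lintegral_map hf (measurable_levelVector a), smul_eq_mul]

/-! ### Truncated aggregates -/

/-- The sum of the first `min n k` coordinates of `x`. -/
noncomputable def truncSum {k : ℕ} (y : ℕ × (Fin k → ℝ)) : ℝ :=
  ∑ i : Fin k, if (i : ℕ) < y.1 then y.2 i else 0

theorem measurable_truncSum {k : ℕ} : Measurable (truncSum : ℕ × (Fin k → ℝ) → ℝ) := by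
  refine Finset.measurable_sum _ fun i _ => Measurable.ite ?_ ?_ measurable_const
  · exact measurable_fst (measurableSet_Ioi (a := (i : ℕ)))
  · exact (measurable_pi_apply i).comp measurable_snd

theorem truncSum_eq (n k : ℕ) (x : ℕ → ℝ) :
    truncSum (n, fun i : Fin k => x i) = ∑ j ∈ Finset.range (min n k), x j := by
  unfold truncSum
  rw [← Finset.sum_range (fun j => if j < n then x j else 0), ← Finset.sum_filter]
  congr 1
  ext j
  simp [and_comm]

theorem truncSum_nonneg {k : ℕ} {y : ℕ × (Fin k → ℝ)} (hy : ∀ i, 0 ≤ y.2 i) :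
    0 ≤ truncSum y :=
  Finset.sum_nonneg fun i _ => by
    split_ifs
    exacts [hy i, le_rfl]

theorem truncSum_mono {k : ℕ} {y z : ℕ × (Fin k → ℝ)} (hz : ∀ i, 0 ≤ z.2 i) (h : y ≤ z) :
    truncSum y ≤ truncSum z := by
  refine Finset.sum_le_sum fun i _ => ?_
  have h1 : y.1 ≤ z.1 := h.1
  have h2 := h.2 i
  have h3 := hz i
  split_ifs
  · exact h2
  · omega
  · exact h3
  · exact le_rfl

/-- Truncated sums are supermodular: a claim that is raised counts for
more when the claim number is raised as well. -/
theorem truncSum_add_le {k : ℕ} (y z : ℕ × (Fin k → ℝ)) :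
    truncSum y + truncSum z ≤ truncSum (y ⊓ z) + truncSum (y ⊔ z) := by
  unfold truncSum
  rw [← Finset.sum_add_distrib, ← Finset.sum_add_distrib]
  refine Finset.sum_le_sum fun i _ => ?_
  simp only [Prod.fst_inf, Prod.snd_inf, Prod.fst_sup, Prod.snd_sup, Pi.inf_apply, Pi.sup_apply,
    lt_inf_iff, lt_sup_iff]
  by_cases h1 : (i : ℕ) < y.1 <;> by_cases h2 : (i : ℕ) < z.1 <;> simp [h1, h2]

theorem levelVector_inter {k : ℕ} (a b : Finset (Fin (k + 1))) (z : (ℕ × ℕ) × (ℕ → ℝ × ℝ)) :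
    levelVector (a ∩ b) z = levelVector a z ⊓ levelVector b z := by
  unfold levelVector
  simp only [Finset.mem_inter, level_and]
  rfl

theorem levelVector_union {k : ℕ} (a b : Finset (Fin (k + 1))) (z : (ℕ × ℕ) × (ℕ → ℝ × ℝ)) :
    levelVector (a ∪ b) z = levelVector a z ⊔ levelVector b z := by
  unfold levelVector
  simp only [Finset.mem_union, level_or]
  rfl

/-- Supermodularity in the set of the coordinates at which the maximum is taken. -/
theorem supermodular_levelVector {ψ : ℝ → ℝ} (hm : Monotone ψ) (hc : ConvexOn ℝ Set.univ ψ)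
    {k : ℕ} {z : (ℕ × ℕ) × (ℕ → ℝ × ℝ)} (hz : ∀ j, 0 ≤ (z.2 j).1 ∧ 0 ≤ (z.2 j).2)
    (a b : Finset (Fin (k + 1))) :
    ψ (truncSum (levelVector a z)) + ψ (truncSum (levelVector b z)) ≤
      ψ (truncSum (levelVector (a ∩ b) z)) + ψ (truncSum (levelVector (a ∪ b) z)) := by
  have hpos : ∀ (c : Finset (Fin (k + 1))) i, 0 ≤ (levelVector c z).2 i :=
    fun c i => le_level _ (hz i).1 (hz i).2
  have hposu := hpos (a ∪ b)
  rw [levelVector_inter, levelVector_union] at *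
  exact add_le_add_of_convexOn_of_monotone hm hc (truncSum_mono (hpos a) inf_le_left)
    (truncSum_mono (hpos b) inf_le_right) (truncSum_mono hposu le_sup_left)
    (truncSum_mono hposu le_sup_right) (truncSum_add_le _ _)

theorem ae_pairMeasure_nonneg (νN : Measure ℕ) {νX : Measure ℝ} [IsProbabilityMeasure νN]
    [IsProbabilityMeasure νX] (hν : ∀ᵐ x ∂νX, 0 < x) :
    ∀ᵐ z ∂(pairMeasure νN νX), ∀ j, 0 ≤ (z.2 j).1 ∧ 0 ≤ (z.2 j).2 := by
  rw [ae_all_iff]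
  intro j
  have h1 : ∀ᵐ y ∂(νX.prod νX), 0 ≤ y.1 ∧ 0 ≤ y.2 := by
    filter_upwards [Measure.quasiMeasurePreserving_fst.ae hν,
      Measure.quasiMeasurePreserving_snd.ae hν] with y h1 h2 using ⟨h1.le, h2.le⟩
  have h2 : ∀ᵐ x ∂(Measure.infinitePi fun _ : ℕ => νX.prod νX), 0 ≤ (x j).1 ∧ 0 ≤ (x j).2 :=
    (measurePreserving_eval_infinitePi (fun _ : ℕ => νX.prod νX) j).quasiMeasurePreserving.ae h1
  exact Measure.quasiMeasurePreserving_snd.ae h2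

/-- The comparison for the first `k` claims, against the mixture in which all levels agree. -/
theorem lintegral_truncSum_le {Ω : Type*} [MeasurableSpace Ω] {P : Measure Ω}
    [IsProbabilityMeasure P] {νN : Measure ℕ} {νX : Measure ℝ} [IsProbabilityMeasure νN]
    [IsProbabilityMeasure νX] {N : Ω → ℕ} {X : ℕ → Ω → ℝ} (hN : Measurable N)
    (hX : ∀ j, Measurable (X j)) {k : ℕ} {θ : Finset (Fin (k + 1)) → ℝ} (hθ : IsAdmissible θ)
    (hJ : HasJointCDF P N X νN νX k (copula θ)) (hν : ∀ᵐ x ∂νX, 0 < x) {ψ : ℝ → ℝ}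
    (hm : Monotone ψ) (hc : ConvexOn ℝ Set.univ ψ) (h0 : ψ 0 = 0) :
    ∫⁻ ω, ENNReal.ofReal (ψ (truncSum (N ω, fun i : Fin k => X i ω))) ∂P ≤
      ENNReal.ofReal (1 / 2) * ∫⁻ z, ENNReal.ofReal
        (ψ (truncSum (levelVector (∅ : Finset (Fin (k + 1))) z))) ∂(pairMeasure νN νX) +
      ENNReal.ofReal (1 / 2) * ∫⁻ z, ENNReal.ofReal
        (ψ (truncSum (levelVector (Finset.univ : Finset (Fin (k + 1))) z)))
          ∂(pairMeasure νN νX) := by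
  have hmeas : Measurable fun y : ℕ × (Fin k → ℝ) => ENNReal.ofReal (ψ (truncSum y)) :=
    (hm.measurable.comp measurable_truncSum).ennreal_ofReal
  have hmeas' : ∀ a : Finset (Fin (k + 1)),
      Measurable fun z => ENNReal.ofReal (ψ (truncSum (levelVector a z))) :=
    fun a => hmeas.comp (measurable_levelVector a)
  rw [lintegral_of_mixture hN hX hJ (mixWeight_nonneg hθ) (copula_eq_mixture θ) hmeas]
  rw [Finset.sum_congr rfl fun a _ => (lintegral_const_mul _ (hmeas' a)).symm,
    ← lintegral_const_mul _ (hmeas' ∅), ← lintegral_const_mul _ (hmeas' Finset.univ)]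
  rw [← lintegral_finsetSum _ fun a _ => (hmeas' a).const_mul _,
    ← lintegral_add_left ((hmeas' _).const_mul _)]
  refine lintegral_mono_ae ?_
  filter_upwards [ae_pairMeasure_nonneg νN hν] with z hz
  have hpos : ∀ a : Finset (Fin (k + 1)), 0 ≤ ψ (truncSum (levelVector a z)) := by
    intro a
    rw [← h0]
    exact hm (truncSum_nonneg fun i => le_level _ (hz i).1 (hz i).2)
  simp_rw [← ENNReal.ofReal_mul (mixWeight_nonneg hθ _)]
  rw [← ENNReal.ofReal_sum_of_nonneg fun a _ => mul_nonneg (mixWeight_nonneg hθ a) (hpos a),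
    ← ENNReal.ofReal_mul (by norm_num), ← ENNReal.ofReal_mul (by norm_num),
    ← ENNReal.ofReal_add (mul_nonneg (by norm_num) (hpos _)) (mul_nonneg (by norm_num) (hpos _))]
  exact ENNReal.ofReal_le_ofReal (sum_mul_le_half_of_supermodular _
    (supermodular_levelVector hm hc hz) _ (mixWeight_nonneg hθ) (sum_mixWeight θ)
    (sum_ite_mixWeight θ))

/-! ### Passage to the full aggregates -/

theorem measurable_aggregate {Ω : Type*} [MeasurableSpace Ω] {N : Ω → ℕ} {X : ℕ → Ω → ℝ}
    (hN : Measurable N) (hX : ∀ j, Measurable (X j)) : Measurable (aggregate N X) := by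
  have h : Measurable fun q : ℕ × Ω => ∑ j ∈ Finset.range q.1, X j q.2 :=
    measurable_from_prod_countable_right fun n =>
      Finset.measurable_sum (Finset.range n) fun j _ => hX j
  exact h.comp (hN.prodMk measurable_id)

/-- It suffices to compare the aggregates of the first `k` claims, for those `k` that do not
exceed the supremum of the support of the claim number; the other truncations are almost surely
equal to one of these or to zero. -/
theorem icxLE_of_truncSum {Ω Ω' : Type*} [MeasurableSpace Ω] [MeasurableSpace Ω']
    {P : Measure Ω} [IsProbabilityMeasure P] {P' : Measure Ω'} [IsProbabilityMeasure P']
    {νN : Measure ℕ} {N : Ω → ℕ} {X : ℕ → Ω → ℝ} {N' : Ω' → ℕ} {X' : ℕ → Ω' → ℝ}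
    (hN : Measurable N) (hX : ∀ j, Measurable (X j)) (hlaw : P.map N = νN)
    (hpos : ∀ᵐ ω ∂P, ∀ j, 0 ≤ X j ω) (hpos' : ∀ᵐ ω ∂P', ∀ j, 0 ≤ X' j ω)
    (h : ∀ ψ : ℝ → ℝ, Monotone ψ → ConvexOn ℝ Set.univ ψ → ψ 0 = 0 →
      ∀ k, 1 ≤ k → LeSupSupport νN k →
        ∫⁻ ω, ENNReal.ofReal (ψ (truncSum (N ω, fun i : Fin k => X i ω))) ∂P ≤
          ∫⁻ ω, ENNReal.ofReal (ψ (truncSum (N' ω, fun i : Fin k => X' i ω))) ∂P') :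
    IcxLE P (aggregate N X) P' (aggregate N' X') := by
  intro φ hm hc hint
  set ψ : ℝ → ℝ := fun x => φ x - φ 0 with hψ
  have hψm : Monotone ψ := fun x y hxy => sub_le_sub_right (hm hxy) _
  have hψc : ConvexOn ℝ Set.univ ψ := by
    simpa only [hψ, sub_eq_add_neg] using! hc.add_const (-φ 0)
  have hψ0 : ψ 0 = 0 := sub_self _
  have hφψ : ∀ x, φ x = ψ x + φ 0 := fun x => (sub_add_cancel _ _).symm
  have hint' : Integrable (fun ω => ψ (aggregate N' X' ω)) P' := hint.sub (integrable_const _)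
  have hS : 0 ≤ᵐ[P] fun ω => ψ (aggregate N X ω) := by
    filter_upwards [hpos] with ω hω
    exact hψ0.symm.trans_le (hψm (Finset.sum_nonneg fun j _ => hω j))
  have hS' : 0 ≤ᵐ[P'] fun ω => ψ (aggregate N' X' ω) := by
    filter_upwards [hpos'] with ω hω
    exact hψ0.symm.trans_le (hψm (Finset.sum_nonneg fun j _ => hω j))
  have htrunc : ∀ k : ℕ,
      ∫⁻ ω, ENNReal.ofReal (ψ (truncSum (N ω, fun i : Fin k => X i ω))) ∂P ≤
        ∫⁻ ω, ENNReal.ofReal (ψ (aggregate N' X' ω)) ∂P' := by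
    intro k
    induction k with
    | zero => simp [truncSum, hψ0]
    | succ k ih =>
      by_cases hk : LeSupSupport νN (k + 1)
      · refine (h ψ hψm hψc hψ0 (k + 1) (Nat.succ_pos k) hk).trans (lintegral_mono_ae ?_)
        filter_upwards [hpos'] with ω hω
        refine ENNReal.ofReal_le_ofReal (hψm ?_)
        rw [truncSum_eq _ _ fun j => X' j ω]
        exact Finset.sum_le_sum_of_subset_of_nonneg
          (Finset.range_mono (min_le_left _ _)) fun j _ _ => hω j
      · -- the claim number is almost surely at most `k`
        have hle : ∀ᵐ ω ∂P, N ω ≤ k := by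
          have hν : ∀ᵐ n ∂νN, n ≤ k := by
            rw [ae_iff_of_countable]
            intro n hn
            by_contra hkn
            exact hk ⟨n, not_le.1 hkn, pos_iff_ne_zero.2 hn⟩
          rw [← hlaw] at hν
          exact ae_of_ae_map hN.aemeasurable hν
        refine (lintegral_congr_ae ?_).trans_le ih
        filter_upwards [hle] with ω hω
        rw [truncSum_eq _ _ fun j => X j ω, truncSum_eq _ _ fun j => X j ω, min_eq_left hω,
          min_eq_left (hω.trans k.le_succ)]
  have hmeasψ : ∀ k : ℕ, Measurable fun ω =>
      ENNReal.ofReal (ψ (truncSum (N ω, fun i : Fin k => X i ω))) := fun k =>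
    (hψm.measurable.comp (measurable_truncSum.comp
      (hN.prodMk (measurable_pi_lambda _ fun i => hX i)))).ennreal_ofReal
  have hle : ∫⁻ ω, ENNReal.ofReal (ψ (aggregate N X ω)) ∂P ≤
      ∫⁻ ω, ENNReal.ofReal (ψ (aggregate N' X' ω)) ∂P' := by
    have hlim : ∀ ω, Filter.liminf (fun k : ℕ =>
        ENNReal.ofReal (ψ (truncSum (N ω, fun i : Fin k => X i ω)))) Filter.atTop =
        ENNReal.ofReal (ψ (aggregate N X ω)) := by
      intro ω
      refine (Filter.Tendsto.congr' ?_ tendsto_const_nhds).liminf_eq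
      filter_upwards [Filter.eventually_ge_atTop (N ω)] with k hk
      rw [truncSum_eq _ _ fun j => X j ω, min_eq_left hk]
      rfl
    simp_rw [← hlim]
    exact (lintegral_liminf_le hmeasψ).trans
      (Filter.liminf_le_of_frequently_le' (Filter.Frequently.of_forall htrunc))
  have hψint : Integrable (fun ω => ψ (aggregate N X ω)) P := by
    refine ⟨(hψm.measurable.comp (measurable_aggregate hN hX)).aestronglyMeasurable, ?_⟩
    rw [hasFiniteIntegral_iff_ofReal hS]
    exact hle.trans_lt ((hasFiniteIntegral_iff_ofReal hS').1 hint'.2)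
  have hψle : ∫ ω, ψ (aggregate N X ω) ∂P ≤ ∫ ω, ψ (aggregate N' X' ω) ∂P' := by
    rw [integral_eq_lintegral_of_nonneg_ae hS hψint.1,
      integral_eq_lintegral_of_nonneg_ae hS' hint'.1]
    exact ENNReal.toReal_mono ((hasFiniteIntegral_iff_ofReal hS').1 hint'.2).ne hle
  simp only [hφψ (aggregate _ _ _)]
  refine ⟨hψint.add (integrable_const _), ?_⟩
  rw [integral_add hψint (integrable_const _), integral_add hint' (integrable_const _)]
  simpa using hψle

/-! ### The two extreme models -/

theorem IsCRM.ae_pos {Ω : Type*} [MeasurableSpace Ω] {P : Measure Ω} {N : Ω → ℕ}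
    {X : ℕ → Ω → ℝ} {νN : Measure ℕ} {νX : Measure ℝ} (h : IsCRM P N X νN νX) :
    ∀ᵐ x ∂νX, 0 < x := by
  rw [← h.law_claim 0]
  exact (ae_map_iff (h.measurable_claim 0).aemeasurable measurableSet_Ioi).2 (h.claim_pos 0)

theorem IsCRM.ae_nonneg {Ω : Type*} [MeasurableSpace Ω] {P : Measure Ω} {N : Ω → ℕ}
    {X : ℕ → Ω → ℝ} {νN : Measure ℕ} {νX : Measure ℝ} (h : IsCRM P N X νN νX) :
    ∀ᵐ ω ∂P, ∀ j, 0 ≤ X j ω :=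
  ae_all_iff.2 fun j => (h.claim_pos j).mono fun _ => le_of_lt

/-- Under the extreme positive dependence copula all coordinates are minima, or all are maxima,
with probability `1/2` each. -/
theorem lintegral_of_hasJointCDF_epdParam {Ω : Type*} [MeasurableSpace Ω] {P : Measure Ω}
    [IsProbabilityMeasure P] {νN : Measure ℕ} {νX : Measure ℝ} [IsProbabilityMeasure νN]
    [IsProbabilityMeasure νX] {N : Ω → ℕ} {X : ℕ → Ω → ℝ} (hN : Measurable N)
    (hX : ∀ j, Measurable (X j)) {k : ℕ} (hJ : HasJointCDF P N X νN νX k (copula epdParam))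
    {f : ℕ × (Fin k → ℝ) → ENNReal} (hf : Measurable f) :
    ∫⁻ ω, f (N ω, fun i => X i ω) ∂P =
      ENNReal.ofReal (1 / 2) * ∫⁻ z, f (levelVector (∅ : Finset (Fin (k + 1))) z)
        ∂(pairMeasure νN νX) +
      ENNReal.ofReal (1 / 2) * ∫⁻ z, f (levelVector (Finset.univ : Finset (Fin (k + 1))) z)
        ∂(pairMeasure νN νX) := by
  have hne : (∅ : Finset (Fin (k + 1))) ≠ Finset.univ := Finset.univ_nonempty.ne_empty.symm
  rw [lintegral_of_mixture hN hX hJ extremeWeight_nonneg copula_epdParam hf,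
    Fintype.sum_eq_add _ _ hne]
  · simp [extremeWeight, hne, hne.symm]
  · intro a ha
    simp [extremeWeight, ha.1, ha.2]

/-- The model with a comonotonic Bernoulli sequence has the same law as under the extreme positive
dependence copula. -/
theorem lintegral_epdMeasure (νN : Measure ℕ) (νX : Measure ℝ) [IsProbabilityMeasure νN]
    [IsProbabilityMeasure νX] {k : ℕ} {f : ℕ × (Fin k → ℝ) → ENNReal} (hf : Measurable f) :
    ∫⁻ ω, f (epdCount ω, fun i => epdClaim i ω) ∂(epdMeasure νN νX) =
      ENNReal.ofReal (1 / 2) * ∫⁻ z, f (levelVector (∅ : Finset (Fin (k + 1))) z)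
        ∂(pairMeasure νN νX) +
      ENNReal.ofReal (1 / 2) * ∫⁻ z, f (levelVector (Finset.univ : Finset (Fin (k + 1))) z)
        ∂(pairMeasure νN νX) := by
  have hform : ∀ ω : EPDSpace, f (epdCount ω, fun i : Fin k => epdClaim i ω) =
      f (levelVector (if ω.1 then (Finset.univ : Finset (Fin (k + 1))) else ∅) ω.2) := by
    rintro ⟨b, z⟩
    cases b <;> simp [levelVector, level, epdCount, epdClaim, epdBernoulli]
  have hmeas : Measurable fun ω : EPDSpace =>
      f (levelVector (if ω.1 then (Finset.univ : Finset (Fin (k + 1))) else ∅) ω.2) :=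
    measurable_from_prod_countable_right fun b =>
      hf.comp (measurable_levelVector (if b then (Finset.univ : Finset (Fin (k + 1))) else ∅))
  have hhalf : ENNReal.ofReal (1 / 2) = 2⁻¹ := by
    rw [one_div, ENNReal.ofReal_inv_of_pos two_pos, ENNReal.ofReal_ofNat]
  simp_rw [hform]
  rw [epdMeasure, lintegral_prod _ hmeas.aemeasurable, lintegral_fintype, Fintype.sum_bool,
    PMF.toMeasure_apply_singleton _ _ (measurableSet_singleton _),
    PMF.toMeasure_apply_singleton _ _ (measurableSet_singleton _), hhalf]
  simp [mul_comm, add_comm]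

theorem ae_epdClaim_nonneg (νN : Measure ℕ) {νX : Measure ℝ} [IsProbabilityMeasure νN]
    [IsProbabilityMeasure νX] (hν : ∀ᵐ x ∂νX, 0 < x) :
    ∀ᵐ ω ∂(epdMeasure νN νX), ∀ j, 0 ≤ epdClaim j ω := by
  have h := Measure.quasiMeasurePreserving_snd
    (μ := (PMF.uniformOfFintype Bool).toMeasure) |>.ae (ae_pairMeasure_nonneg νN hν)
  filter_upwards [h] with ω hω j
  unfold epdClaim
  split_ifs
  · exact le_max_of_le_left (hω j).1
  · exact le_min (hω j).1 (hω j).2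

end FGM

theorem mainTheorem7
    {Ω : Type*} [MeasurableSpace Ω] (P : Measure Ω) [IsProbabilityMeasure P]
    (νN : Measure ℕ) [IsProbabilityMeasure νN] (νX : Measure ℝ) [IsProbabilityMeasure νX]
    (N : Ω → ℕ) (X : ℕ → Ω → ℝ)
    (hCRM : FGM.IsCRM P N X νN νX) (hFGM : FGM.HasFGMDependence P N X νN νX) :
    FGM.IcxLE P (FGM.aggregate N X)
      (FGM.epdMeasure νN νX) (FGM.aggregate FGM.epdCount FGM.epdClaim) ∧
    ∀ {Ω' : Type*} [MeasurableSpace Ω'] (P' : Measure Ω') [IsProbabilityMeasure P']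
      (N' : Ω' → ℕ) (X' : ℕ → Ω' → ℝ),
      FGM.IsCRM P' N' X' νN νX → FGM.HasEPDDependence P' N' X' νN νX →
        FGM.IcxLE P (FGM.aggregate N X) P' (FGM.aggregate N' X') := by
  have hν := hCRM.ae_pos
  have hmeas : ∀ {ψ : ℝ → ℝ}, Monotone ψ → ∀ k : ℕ, Measurable fun y : ℕ × (Fin k → ℝ) =>
      ENNReal.ofReal (ψ (FGM.truncSum y)) :=
    fun hm _ => (hm.measurable.comp FGM.measurable_truncSum).ennreal_ofReal
  refine ⟨?_, fun {Ω'} _ P' _ N' X' hCRM' hEPD => ?_⟩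
  · have : IsProbabilityMeasure (FGM.epdMeasure νN νX) := by
      unfold FGM.epdMeasure
      infer_instance
    refine FGM.icxLE_of_truncSum hCRM.measurable_count hCRM.measurable_claim hCRM.law_count
      hCRM.ae_nonneg (FGM.ae_epdClaim_nonneg νN hν) fun ψ hm hc h0 k hk hsup => ?_
    obtain ⟨θ, hθ, hJ⟩ := hFGM k hk hsup
    rw [FGM.lintegral_epdMeasure νN νX (hmeas hm k)]
    exact FGM.lintegral_truncSum_le hCRM.measurable_count hCRM.measurable_claim hθ hJ hν hm hc h0
  · refine FGM.icxLE_of_truncSum hCRM.measurable_count hCRM.measurable_claim hCRM.law_count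
      hCRM.ae_nonneg hCRM'.ae_nonneg fun ψ hm hc h0 k hk hsup => ?_
    obtain ⟨θ, hθ, hJ⟩ := hFGM k hk hsup
    rw [FGM.lintegral_of_hasJointCDF_epdParam hCRM'.measurable_count hCRM'.measurable_claim
      (hEPD k hk hsup) (hmeas hm k)]
    exact FGM.lintegral_truncSum_le hCRM.measurable_count hCRM.measurable_claim hθ hJ hν hm hc h0
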